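/- Let $\mathbb T=\mathbb R/\mathbb Z$ and let $T(t,s)=(t,s+t)$ on $\mathbb T^2$, equipped with the product Lebesgue measure $\lambda=dt\times ds$. A joining of two measure-preserving systems $(X,T,\mu)$ and $(Y,S,\nu)$ is a $T\times S$-invariant measure $\xi$ on $X\times Y$ with marginals $\mu$ and $\nu$; the systems are disjoint if $\int f(x)g(y)\,d\xi=\int f\,d\mu\cdot\int g\,d\nu$ for every joining $\xi$ and all bounded measurable complex functions $f$ on $X$ and $g$ on $Y$. For shift-invariant probability measures $\mu$ on $K^{\mathbb N}$ and $\nu$ on $L^{\mathbb N}$, where $K,L$ are finite subsets of the closed unit disc in $\mathbb C$, put $\mathrm{corr}(\mu,\nu)=\sup_\xi\bigl|\int x_1\overline{y_1}\,d\xi-\int x_1\,d\mu\cdot\int\overline{y_1}\,d\nu\bigr|$, the supremum being over all joinings $\xi$ of $\mu$ and $\nu$; the measures are uncorrelated if $\mathrm{corr}(\mu,\nu)=0$. Call $t\in\mathbb T$ ergodic if the rotation $s\mapsto s+t$ of $\mathbb T$ is ergodic for $ds$. (1) The measure $\lambda$ is $T$-invariant, almost every $t\in\mathbb T$ is ergodic,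 and $\lambda$ is disjoint from every ergodic probability measure-preserving system. (2) Let $K$ be a finite subset of the closed unit disc, let $P:\mathbb T^2\to K$ be measurable (a measurable finite partition of $\mathbb T^2$ with cells labelled by elements of $K$), let $\pi(z)=(P(T^{n-1}z))_{n\ge1}\in K^{\mathbb N}$, and let $\mu=\pi_*\lambda$. Then $\mu$ is a shift-invariant probability measure, $\pi$ is a factor map from $(\mathbb T^2,T,\lambda)$ to $K^{\mathbb N}$ with the shift and the measure $\mu$, $\mu$ is disjoint from every ergodic probability measure-preserving system, and $\mu$ is uncorrelated to every ergodic shift-invariant probability measure on $L^{\mathbb N}$, for every finite subset $L$ of the closed unit disc. Moreover $\mu=\int_{\mathbb T}\mu_t\,dt$, where $\mu_t$ is the image of $ds$ under $s\mapsto\pi(t,s)$, and $\mu_t$ is ergodic under the shift for every ergodic $t$. (3) Suppose in addition that $P$ partitions every ergodic circle nontrivially, i.e. for every ergodic $t$ and every $a\in K$ the set $\{s: P(t,s)=a\}$ does not have full measure. Then $\mu_t$ is not a point mass, for every ergodic $t$. If $K$ has at least two elements, such $P$ exist. -/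

import Mathlib

open MeasureTheory

/-- A joining of the measure-preserving systems `(X, T, μ)` and `(Y, S, ν)`: a `T × S`-invariant
measure on `X × Y` whose marginals are `μ` and `ν`. -/
structure IsJoining {X Y : Type*} [MeasurableSpace X] [MeasurableSpace Y]
    (T : X → X) (μ : Measure X) (S : Y → Y) (ν : Measure Y) (ξ : Measure (X × Y)) : Prop where
  map_fst : ξ.map Prod.fst = μ
  map_snd : ξ.map Prod.snd = ν
  invariant : MeasurePreserving (Prod.map T S) ξ ξ

/-- Disjointness in the sense of Furstenberg: `∫ f(x) g(y) dξ = ∫ f dμ · ∫ g dν` for every joining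
`ξ` and all bounded measurable functions `f` and `g`. -/
def FurstenbergDisjoint {X Y : Type*} [MeasurableSpace X] [MeasurableSpace Y]
    (T : X → X) (μ : Measure X) (S : Y → Y) (ν : Measure Y) : Prop :=
  ∀ ξ : Measure (X × Y), IsJoining T μ S ν ξ →
    ∀ (f : X → ℂ) (g : Y → ℂ), Measurable f → Measurable g →
      (∃ C : ℝ, ∀ x, ‖f x‖ ≤ C) → (∃ C : ℝ, ∀ y, ‖g y‖ ≤ C) →
      ∫ z, f z.1 * g z.2 ∂ξ = (∫ x, f x ∂μ) * ∫ y, g y ∂ν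

/-- The left shift on one-sided sequences. The first symbol of `x` is `x 0`. -/
def shift {A : Type*} (x : ℕ → A) : ℕ → A := fun n => x (n + 1)

/-- The correlation of shift-invariant measures `μ` on `K^ℕ` and `ν` on `L^ℕ` (`K`, `L` finite sets
of complex numbers): the supremum over all joinings `ξ` of
`|∫ x₁ conj(y₁) dξ - ∫ x₁ dμ · ∫ conj(y₁) dν|`, taken in `[0, ∞]`. -/
noncomputable def corr {K L : Finset ℂ} (μ : Measure (ℕ → K)) (ν : Measure (ℕ → L)) : ENNReal :=
  ⨆ (ξ : Measure ((ℕ → K) × (ℕ → L))) (_ : IsJoining shift μ shift ν ξ),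
    ‖(∫ z, (z.1 0 : ℂ) * starRingEnd ℂ (z.2 0 : ℂ) ∂ξ)
        - (∫ x, (x 0 : ℂ) ∂μ) * ∫ y, starRingEnd ℂ (y 0 : ℂ) ∂ν‖ₑ

/-- Two shift-invariant measures are uncorrelated if their correlation is zero. -/
def Uncorrelated {K L : Finset ℂ} (μ : Measure (ℕ → K)) (ν : Measure (ℕ → L)) : Prop :=
  corr μ ν = 0

/-- The two-dimensional torus `(ℝ/ℤ) × (ℝ/ℤ)`; its `volume` is the product `dt × ds` of the
normalized Lebesgue measures. -/
abbrev Torus2 : Type := UnitAddCircle × UnitAddCircle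

/-- The map `T(t, s) = (t, s + t)`. -/
def skewMap (z : Torus2) : Torus2 := (z.1, z.2 + z.1)

/-- The rotation by `t`, which is the action of `skewMap` on the invariant circle `{t} × (ℝ/ℤ)`. -/
def circleRotation (t : UnitAddCircle) (s : UnitAddCircle) : UnitAddCircle := s + t

/-- The itinerary of `z` under `skewMap` with respect to a labelled partition: `P z` is the label
of the cell that contains `z`. -/
def itinerary {K : Finset ℂ} (P : Torus2 → K) (z : Torus2) : ℕ → K :=
  fun n => P (skewMap^[n] z)

/-- The symbolic factor of the Lebesgue measure `dt × ds` induced by the partition `P`. -/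
noncomputable def symbolicFactor {K : Finset ℂ} (P : Torus2 → K) : Measure (ℕ → K) :=
  (volume : Measure Torus2).map (itinerary P)

/-- The image under the itinerary map of the normalized Lebesgue measure on the circle
`{t} × (ℝ/ℤ)`. -/
noncomputable def factorComponent {K : Finset ℂ} (P : Torus2 → K) (t : UnitAddCircle) :
    Measure (ℕ → K) :=
  (volume : Measure UnitAddCircle).map (fun s => itinerary P (t, s))

/-- The partition `P` is nontrivial (modulo null sets) on every circle `{t} × (ℝ/ℤ)` on which
`skewMap` is ergodic: no cell contains almost all of the circle. -/
def NontrivialOnErgodicCircles {K : Finset ℂ} (P : Torus2 → K) : Prop :=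
  ∀ t : UnitAddCircle, Ergodic (circleRotation t) (volume : Measure UnitAddCircle) →
    ∀ a : K, ¬ ∀ᵐ s : UnitAddCircle, P (t, s) = a

/-! Disjointness is tested on characters e(jt + ks) of the torus. For k = 0 the character is
invariant, and averaging over the orbit replaces g by its ergodic averages, which converge to the
constant ∫ g dν in L¹ (`tendsto_integral_mul_of_invariant`). For k ≠ 0 the average contains D = ∑
e(knt) g(Sⁿy), n < N. In |D|² the off-diagonal terms are e(k(n-m)t), an invariant function with
integral zero, times a function of y. The case k = 0 kills them in every joining. The N diagonal
terms remain, so the average is O(N^(-1/2)) in L². Density of trigonometric polynomials in L¹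
finishes the argument.

A joining of a factor with an ergodic system lifts to a coupling over the torus by the conditional
law of the point given its image (`exists_lift_coupling`). Invariance of this lift is neither proved
nor needed: its Cesàro averages are asymptotically invariant and all project to the given joining.
The argument above is therefore run for asymptotic joinings, without extracting a limit measure, and
covers true joinings as constant families. -/

open Filter Topology

/-! ### The mean ergodic theorem in L¹. -/

/-- Bounded measurable functions are integrable for finite measures. -/
lemma integrable_of_measurable_of_bounded {X : Type*} [MeasurableSpace X] {μ : Measure X}
    [IsFiniteMeasure μ] {f : X → ℂ} (hf : Measurable f) (hb : ∃ C : ℝ, ∀ x, ‖f x‖ ≤ C) :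
    Integrable f μ := by
  obtain ⟨C, hC⟩ := hb
  exact Integrable.of_bound hf.aestronglyMeasurable C (ae_of_all _ hC)

/-- The mean ergodic theorem in `L¹` for bounded measurable functions. -/
lemma tendsto_integral_norm_average_sub_integral {Y : Type*} [MeasurableSpace Y] {S : Y → Y}
    {ν : Measure Y} [IsProbabilityMeasure ν] (hS : Ergodic S ν) {g : Y → ℂ} (hg : Measurable g)
    (hb : ∃ C : ℝ, ∀ y, ‖g y‖ ≤ C) :
    Tendsto (fun N : ℕ => ∫ y, ‖(N : ℂ)⁻¹ * ∑ n ∈ Finset.range N, g (S^[n] y) - ∫ y, g y ∂ν‖ ∂ν)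
      atTop (𝓝 0) := by
  have hmem : MemLp g 2 ν := by
    obtain ⟨C, hC⟩ := hb
    exact MemLp.of_bound hg.aestronglyMeasurable C (ae_of_all _ hC)
  let U : Lp ℂ 2 ν →L[ℂ] Lp ℂ 2 ν :=
    (Lp.compMeasurePreservingₗᵢ ℂ S hS.toMeasurePreserving).toContinuousLinearMap
  have hU : ‖U‖ ≤ 1 := LinearIsometry.norm_toContinuousLinearMap_le _
  have hUapp : ∀ F, U F = Lp.compMeasurePreserving S hS.toMeasurePreserving F := fun _ => rfl
  have key := U.tendsto_birkhoffAverage_orthogonalProjection hU (hmem.toLp g)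
  set p := (U.eqLocus (1 : Lp ℂ 2 ν →L[ℂ] Lp ℂ 2 ν)).orthogonalProjectionOnto (hmem.toLp g)
  have hiter : ∀ n : ℕ, ((U^[n] (hmem.toLp g) : Lp ℂ 2 ν) : Y → ℂ) =ᵐ[ν] fun y => g (S^[n] y) := by
    intro n
    have : ∀ F, U^[n] F = Lp.compMeasurePreserving S^[n] (hS.toMeasurePreserving.iterate n) F := by
      intro F
      rw [← Lp.compMeasurePreserving_iterate]
      rfl
    rw [this]
    refine (Lp.coeFn_compMeasurePreserving _ _).trans ?_
    exact (hS.toMeasurePreserving.iterate n).quasiMeasurePreserving.ae_eq_comp hmem.coeFn_toLp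
  have hav : ∀ N : ℕ, ((birkhoffAverage ℂ U id N (hmem.toLp g) : Lp ℂ 2 ν) : Y → ℂ) =ᵐ[ν]
      fun y => (N : ℂ)⁻¹ * ∑ n ∈ Finset.range N, g (S^[n] y) := by
    intro N
    simp only [birkhoffAverage, birkhoffSum, id]
    have h1 : ((∑ n ∈ Finset.range N, U^[n] (hmem.toLp g) : Lp ℂ 2 ν) : Y → ℂ) =ᵐ[ν]
        fun y => ∑ n ∈ Finset.range N, g (S^[n] y) := by
      have h2 : ∀ᵐ y ∂ν, ∀ n : ℕ, ((U^[n] (hmem.toLp g) : Lp ℂ 2 ν) : Y → ℂ) y = g (S^[n] y) :=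
        ae_all_iff.2 hiter
      filter_upwards [h2, Lp.coeFn_finsetSum (Finset.range N) (fun n => U^[n] (hmem.toLp g))]
        with y hy hs
      rw [hs]
      simp [hy]
    filter_upwards [h1, Lp.coeFn_smul ((N : ℂ)⁻¹) (∑ n ∈ Finset.range N, U^[n] (hmem.toLp g))]
      with y hy hs
    rw [hs, Pi.smul_apply, hy, smul_eq_mul]
  obtain ⟨c, hc⟩ : ∃ c : ℂ, ((p : Lp ℂ 2 ν) : Y → ℂ) =ᵐ[ν] fun _ => c := by
    have hfix : U (p : Lp ℂ 2 ν) = p := p.2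
    refine hS.ae_eq_const_of_ae_eq_comp_ae (Lp.aestronglyMeasurable _) ?_
    rw [hUapp] at hfix
    have := Lp.coeFn_compMeasurePreserving (p : Lp ℂ 2 ν) hS.toMeasurePreserving
    rw [hfix] at this
    exact this.symm
  have hL1 : Tendsto (fun N : ℕ => ∫ y, ‖(N : ℂ)⁻¹ * ∑ n ∈ Finset.range N, g (S^[n] y) - c‖ ∂ν)
      atTop (𝓝 0) := by
    have hn : Tendsto (fun N : ℕ => ‖birkhoffAverage ℂ U id N (hmem.toLp g) -
        (p : Lp ℂ 2 ν)‖) atTop (𝓝 0) := tendsto_iff_norm_sub_tendsto_zero.1 key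
    refine squeeze_zero (fun N => integral_nonneg fun y => norm_nonneg _) (fun N => ?_) hn
    have hae : (fun y => ‖(N : ℂ)⁻¹ * ∑ n ∈ Finset.range N, g (S^[n] y) - c‖) =ᵐ[ν]
        fun y => ‖((birkhoffAverage ℂ U id N (hmem.toLp g) - (p : Lp ℂ 2 ν) :
          Lp ℂ 2 ν) : Y → ℂ) y‖ := by
      filter_upwards [hav N, hc, Lp.coeFn_sub (birkhoffAverage ℂ U id N (hmem.toLp g))
        (p : Lp ℂ 2 ν)] with y h1 h2 h3
      rw [h3, Pi.sub_apply, h1, h2]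
    -- On a probability space the L¹ norm is at most the L² norm.
    rw [integral_congr_ae hae, Lp.norm_def,
      integral_norm_eq_lintegral_enorm (Lp.aestronglyMeasurable _)]
    refine ENNReal.toReal_mono (Lp.eLpNorm_ne_top _) ?_
    rw [← eLpNorm_one_eq_lintegral_enorm]
    exact eLpNorm_le_eLpNorm_of_exponent_le (by norm_num) (Lp.aestronglyMeasurable _)
  have hgi : ∀ n : ℕ, Integrable (fun y => g (S^[n] y)) ν := fun n =>
    (hS.toMeasurePreserving.iterate n).integrable_comp_of_integrable
      (integrable_of_measurable_of_bounded hg hb)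
  have hint : ∀ n : ℕ, ∫ y, g (S^[n] y) ∂ν = ∫ y, g y ∂ν := fun n => by
    have h := hS.toMeasurePreserving.iterate n
    conv_rhs => rw [← h.map_eq]
    rw [integral_map h.measurable.aemeasurable hg.aestronglyMeasurable]
  -- Every average with N > 0 has integral ∫ g dν, so L¹ convergence identifies the constant.
  have hcg : ∫ y, g y ∂ν = c := by
    have h1 : ∀ᶠ N : ℕ in atTop, ‖∫ y, g y ∂ν - c‖ ≤
        ∫ y, ‖(N : ℂ)⁻¹ * ∑ n ∈ Finset.range N, g (S^[n] y) - c‖ ∂ν := by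
      filter_upwards [eventually_gt_atTop 0] with N hN
      have hN' : (N : ℂ) ≠ 0 := by exact_mod_cast hN.ne'
      have : ∫ y, ((N : ℂ)⁻¹ * ∑ n ∈ Finset.range N, g (S^[n] y) - c) ∂ν = ∫ y, g y ∂ν - c := by
        rw [integral_sub ((integrable_finsetSum _ fun n _ => hgi n).const_mul _)
          (integrable_const _), integral_const_mul, integral_finsetSum _ fun n _ => hgi n]
        simp [hint, hN']
      rw [← this]
      exact norm_integral_le_integral_norm _
    have h2 := ge_of_tendsto hL1 h1
    exact sub_eq_zero.1 (norm_le_zero_iff.1 h2)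
  rw [hcg]
  exact hL1

/-! ### Asymptotic joinings and invariant functions. -/

/-- A family of couplings of `(X, T, μ)` and `(Y, S, ν)` that is asymptotically `T × S`-invariant
along the filter `l`. -/
structure IsAsymptoticJoining {ι X Y : Type*} [MeasurableSpace X] [MeasurableSpace Y]
    (T : X → X) (μ : Measure X) (S : Y → Y) (ν : Measure Y) (ξ : ι → Measure (X × Y))
    (l : Filter ι) : Prop where
  map_fst : ∀ i, (ξ i).map Prod.fst = μ
  map_snd : ∀ i, (ξ i).map Prod.snd = ν
  tendsto_comp_sub : ∀ Φ : X × Y → ℂ, Measurable Φ → (∃ C : ℝ, ∀ w, ‖Φ w‖ ≤ C) →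
    Tendsto (fun i => ∫ w, Φ (Prod.map T S w) ∂ξ i - ∫ w, Φ w ∂ξ i) l (𝓝 0)

/-- This fixes the order of limits: `y` will be an N-step orbit average with N chosen from ε, and
only then does `i` run along the filter. -/
lemma tendsto_of_forall_approx {ι : Type*} {l : Filter ι} {x : ι → ℂ} {a : ℂ}
    (h : ∀ ε : ℝ, 0 < ε → ∃ y : ι → ℂ, Tendsto (fun i => y i - x i) l (𝓝 0) ∧
      ∀ᶠ i in l, ‖y i - a‖ ≤ ε) : Tendsto x l (𝓝 a) := by
  rw [Metric.tendsto_nhds]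
  intro ε hε
  obtain ⟨y, hy, hya⟩ := h (ε / 2) (half_pos hε)
  rw [Metric.tendsto_nhds] at hy
  filter_upwards [hy (ε / 2) (half_pos hε), hya] with i h1 h2
  rw [dist_zero_right] at h1
  calc dist (x i) a = ‖(y i - a) - (y i - x i)‖ := by rw [dist_eq_norm]; congr 1; ring
    _ ≤ ‖y i - a‖ + ‖y i - x i‖ := norm_sub_le _ _
    _ < ε := by linarith

namespace IsAsymptoticJoining

variable {ι X Y : Type*} [MeasurableSpace X] [MeasurableSpace Y] {T : X → X} {μ : Measure X}
  {S : Y → Y} {ν : Measure Y} {ξ : ι → Measure (X × Y)} {l : Filter ι}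

lemma isProbabilityMeasure [IsProbabilityMeasure ν] (hξ : IsAsymptoticJoining T μ S ν ξ l)
    (i : ι) : IsProbabilityMeasure (ξ i) := by
  have h := hξ.map_snd i
  constructor
  have h1 : (ξ i).map Prod.snd Set.univ = 1 := by rw [h]; exact measure_univ
  rwa [Measure.map_apply measurable_snd MeasurableSet.univ, Set.preimage_univ] at h1

lemma integral_fst {E : Type*} [NormedAddCommGroup E] [NormedSpace ℝ E]
    (hξ : IsAsymptoticJoining T μ S ν ξ l) (i : ι) {f : X → E}
    (hf : AEStronglyMeasurable f μ) : ∫ w, f w.1 ∂ξ i = ∫ x, f x ∂μ := by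
  rw [← hξ.map_fst i] at hf ⊢
  rw [integral_map measurable_fst.aemeasurable hf]

lemma integral_snd {E : Type*} [NormedAddCommGroup E] [NormedSpace ℝ E]
    (hξ : IsAsymptoticJoining T μ S ν ξ l) (i : ι) {g : Y → E}
    (hg : AEStronglyMeasurable g ν) : ∫ w, g w.2 ∂ξ i = ∫ y, g y ∂ν := by
  rw [← hξ.map_snd i] at hg ⊢
  rw [integral_map measurable_snd.aemeasurable hg]

/-- One-step asymptotic invariance holds for all bounded measurable test functions, hence also for Φ
composed with an iterate; the errors add up. -/
lemma tendsto_iterate_sub (hξ : IsAsymptoticJoining T μ S ν ξ l) (hT : Measurable T)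
    (hS : Measurable S) {Φ : X × Y → ℂ} (hΦ : Measurable Φ) (hb : ∃ C : ℝ, ∀ w, ‖Φ w‖ ≤ C)
    (n : ℕ) :
    Tendsto (fun i => ∫ w, Φ (T^[n] w.1, S^[n] w.2) ∂ξ i - ∫ w, Φ w ∂ξ i) l (𝓝 0) := by
  induction n with
  | zero => simpa using tendsto_const_nhds
  | succ n ih =>
    have hm : Measurable fun w : X × Y => Φ (T^[n] w.1, S^[n] w.2) :=
      hΦ.comp (((hT.iterate n).comp measurable_fst).prodMk ((hS.iterate n).comp measurable_snd))
    have := (hξ.tendsto_comp_sub _ hm ⟨hb.choose, fun w => hb.choose_spec _⟩).add ih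
    simpa using this

lemma tendsto_average_sub [IsProbabilityMeasure ν] (hξ : IsAsymptoticJoining T μ S ν ξ l)
    (hT : Measurable T) (hS : Measurable S) {Φ : X × Y → ℂ} (hΦ : Measurable Φ)
    (hb : ∃ C : ℝ, ∀ w, ‖Φ w‖ ≤ C) {N : ℕ} (hN : N ≠ 0) :
    Tendsto (fun i => ∫ w, (N : ℂ)⁻¹ * ∑ n ∈ Finset.range N, Φ (T^[n] w.1, S^[n] w.2) ∂ξ i -
      ∫ w, Φ w ∂ξ i) l (𝓝 0) := by
  have hN' : (N : ℂ) ≠ 0 := by exact_mod_cast hN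
  have h := (tendsto_finsetSum (Finset.range N)
    fun n _ => hξ.tendsto_iterate_sub hT hS hΦ hb n).const_mul (N : ℂ)⁻¹
  simp only [Finset.sum_const_zero, mul_zero] at h
  refine h.congr fun i => ?_
  have := hξ.isProbabilityMeasure i
  rw [integral_const_mul, integral_finsetSum]
  · rw [Finset.sum_sub_distrib, mul_sub]
    simp [hN']
  · intro n _
    exact integrable_of_measurable_of_bounded (hΦ.comp (((hT.iterate n).comp
      measurable_fst).prodMk ((hS.iterate n).comp measurable_snd)))
      ⟨hb.choose, fun w => hb.choose_spec _⟩

/-- Invariant functions become independent of an ergodic system. -/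
lemma tendsto_integral_mul_of_invariant [IsProbabilityMeasure ν]
    (hξ : IsAsymptoticJoining T μ S ν ξ l) (hT : Measurable T) (hS : Ergodic S ν) {h : X → ℂ}
    {g : Y → ℂ} (hh : Measurable h) (hhb : ∃ C : ℝ, ∀ x, ‖h x‖ ≤ C) (hinv : ∀ x, h (T x) = h x)
    (hg : Measurable g) (hgb : ∃ C : ℝ, ∀ y, ‖g y‖ ≤ C) :
    Tendsto (fun i => ∫ w, h w.1 * g w.2 ∂ξ i) l (𝓝 ((∫ x, h x ∂μ) * ∫ y, g y ∂ν)) := by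
  obtain ⟨C, hC⟩ := hhb
  obtain ⟨D, hD⟩ := hgb
  have hiter : ∀ (n : ℕ) (x : X), h (T^[n] x) = h x := by
    intro n
    induction n with
    | zero => simp
    | succ n ih => intro x; rw [Function.iterate_succ_apply, ih, hinv]
  refine tendsto_of_forall_approx fun ε hε => ?_
  -- N makes |C| times the L¹ error of the ergodic average at most ε. This bound is uniform in `i`
  -- because the second marginal is always ν.
  have hlim := (tendsto_integral_norm_average_sub_integral hS hg ⟨D, hD⟩).const_mul |C|
  rw [mul_zero] at hlim
  obtain ⟨N, hN, hN0⟩ := ((hlim.eventually (ge_mem_nhds hε)).and (eventually_ne_atTop 0)).exists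
  set c := ∫ y, g y ∂ν
  have hav : Measurable fun y => (N : ℂ)⁻¹ * ∑ n ∈ Finset.range N, g (S^[n] y) :=
    (Finset.measurable_fun_sum _ fun n _ => hg.comp (hS.measurable.iterate n)).const_mul _
  refine ⟨_, hξ.tendsto_average_sub (Φ := fun w => h w.1 * g w.2) hT hS.measurable
    ((hh.comp measurable_fst).mul (hg.comp measurable_snd)) ⟨|C| * |D|, fun w => ?_⟩ hN0,
    Eventually.of_forall fun i => ?_⟩
  · rw [norm_mul]
    exact mul_le_mul ((hC _).trans (le_abs_self _)) ((hD _).trans (le_abs_self _))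
      (norm_nonneg _) (abs_nonneg _)
  · have := hξ.isProbabilityMeasure i
    have hsum : ∀ w : X × Y, (N : ℂ)⁻¹ * ∑ n ∈ Finset.range N,
        h (T^[n] w.1) * g (S^[n] w.2) - h w.1 * c =
        h w.1 * ((N : ℂ)⁻¹ * ∑ n ∈ Finset.range N, g (S^[n] w.2) - c) := by
      intro w
      simp only [hiter, ← Finset.mul_sum]
      ring
    have hDav : ∀ y, ‖(N : ℂ)⁻¹ * ∑ n ∈ Finset.range N, g (S^[n] y)‖ ≤
        ‖(N : ℂ)⁻¹‖ * (N * D) := fun y => by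
      rw [norm_mul]
      gcongr
      refine (norm_sum_le _ _).trans ((Finset.sum_le_sum fun n _ => hD _).trans ?_)
      simp
    have hi1 : Integrable (fun w : X × Y => h w.1 * c) (ξ i) :=
      (integrable_of_measurable_of_bounded (hh.comp measurable_fst)
        ⟨C, fun w => hC _⟩).mul_const c
    have hi2 : Integrable (fun w : X × Y => h w.1 *
        ((N : ℂ)⁻¹ * ∑ n ∈ Finset.range N, g (S^[n] w.2) - c)) (ξ i) := by
      refine integrable_of_measurable_of_bounded ((hh.comp measurable_fst).mul
        ((hav.comp measurable_snd).sub_const c)) ⟨|C| * (‖(N : ℂ)⁻¹‖ * (N * D) + ‖c‖), fun w => ?_⟩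
      rw [norm_mul]
      refine mul_le_mul ((hC _).trans (le_abs_self _)) ?_ (norm_nonneg _) (abs_nonneg _)
      exact (norm_sub_le _ _).trans (add_le_add_left (hDav _) _)
    have hcalc : ∫ w : X × Y, (N : ℂ)⁻¹ * ∑ n ∈ Finset.range N,
        h (T^[n] w.1) * g (S^[n] w.2) ∂ξ i - (∫ x, h x ∂μ) * c =
        ∫ w : X × Y, h w.1 * ((N : ℂ)⁻¹ * ∑ n ∈ Finset.range N, g (S^[n] w.2) - c) ∂ξ i := by
      rw [← hξ.integral_fst i hh.aestronglyMeasurable, ← integral_mul_const, ← integral_sub _ hi1]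
      · exact integral_congr_ae (ae_of_all _ hsum)
      · refine (hi2.add hi1).congr (ae_of_all _ fun w => ?_)
        rw [Pi.add_apply, ← hsum w]
        ring
    rw [hcalc]
    refine le_trans ?_ hN
    rw [← hξ.integral_snd i (hav.sub_const c).norm.aestronglyMeasurable, ← integral_const_mul]
    refine norm_integral_le_of_norm_le ?_ (ae_of_all _ fun w => ?_)
    · have : Integrable (fun w : X × Y =>
          (N : ℂ)⁻¹ * ∑ n ∈ Finset.range N, g (S^[n] w.2) - c) (ξ i) :=
        (integrable_of_measurable_of_bounded (hav.comp measurable_snd)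
          ⟨_, fun w => hDav _⟩).sub (integrable_const c)
      exact this.norm.const_mul _
    · rw [norm_mul]
      gcongr
      exact (hC _).trans (le_abs_self _)

end IsAsymptoticJoining

/-! ### The skew map and the characters of the circle. -/

instance : IsProbabilityMeasure (volume : Measure UnitAddCircle) :=
  ⟨UnitAddCircle.measure_univ⟩

instance : IsProbabilityMeasure (volume : Measure Torus2) :=
  inferInstanceAs (IsProbabilityMeasure ((volume : Measure UnitAddCircle).prod volume))

lemma measurePreserving_skewMap : MeasurePreserving skewMap (volume : Measure Torus2) volume :=
  (MeasurePreserving.id (volume : Measure UnitAddCircle)).skew_product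
    (g := fun t s : UnitAddCircle => s + t) (measurable_snd.add measurable_fst)
    (ae_of_all _ fun t => (measurePreserving_add_right volume t).map_eq)

lemma measurable_skewMap : Measurable skewMap := measurePreserving_skewMap.measurable

lemma skewMap_iterate (n : ℕ) (z : Torus2) : skewMap^[n] z = (z.1, z.2 + n • z.1) := by
  induction n with
  | zero => simp
  | succ n ih => rw [Function.iterate_succ_apply', ih, skewMap, succ_nsmul, add_assoc]

/-- Translation by 1/(2n) preserves the measure and changes the sign of the character. -/
lemma integral_fourier_eq_zero {n : ℤ} (hn : n ≠ 0) :
    ∫ t : UnitAddCircle, (fourier n t : ℂ) = 0 :=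
  integral_eq_zero_of_add_right_eq_neg (fourier_add_half_inv_index hn one_pos)

lemma norm_fourier_apply (n : ℤ) (t : UnitAddCircle) : ‖(fourier n t : ℂ)‖ = 1 := by
  rw [fourier_apply, Circle.norm_coe]

lemma measurable_fourier (n : ℤ) : Measurable fun t : UnitAddCircle => (fourier n t : ℂ) :=
  (fourier n).continuous.measurable

/-- The phase gained along the orbit depends only on the invariant coordinate `t`; this produces the
twist in the averages below. -/
lemma fourier_add_nsmul (k : ℤ) (n : ℕ) (s t : UnitAddCircle) :
    (fourier k (s + n • t) : ℂ) = fourier k s * fourier (k * n) t := by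
  simp only [fourier_apply, smul_add, AddCircle.toCircle_add, Circle.coe_mul, mul_smul,
    natCast_zsmul]

lemma integral_torus_fst {f : UnitAddCircle → ℂ} (hf : Measurable f) :
    ∫ z : Torus2, f z.1 = ∫ t, f t := by
  have h : (volume : Measure Torus2).map Prod.fst = volume := measurePreserving_fst.map_eq
  conv_rhs => rw [← h]
  rw [integral_map measurable_fst.aemeasurable hf.aestronglyMeasurable]

/-! ### Characters that are nontrivial on the circles. -/

namespace IsAsymptoticJoining

variable {ι Y : Type*} [MeasurableSpace Y] {S : Y → Y} {ν : Measure Y} [IsProbabilityMeasure ν]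
  {ξ : ι → Measure (Torus2 × Y)} {l : Filter ι} {g : Y → ℂ}

/-- The second moment of the twisted averages of `g` in the limit: the off-diagonal terms vanish. -/
lemma tendsto_integral_twisted_average_sq
    (hξ : IsAsymptoticJoining skewMap volume S ν ξ l) (hS : Ergodic S ν) (hg : Measurable g)
    (hgb : ∃ C : ℝ, ∀ y, ‖g y‖ ≤ C) {k : ℤ} (hk : k ≠ 0) (N : ℕ) :
    Tendsto (fun i => ∫ w, (∑ n ∈ Finset.range N, fourier (k * n) w.1.1 * g (S^[n] w.2)) *
        starRingEnd ℂ (∑ n ∈ Finset.range N, fourier (k * n) w.1.1 * g (S^[n] w.2)) ∂ξ i) l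
      (𝓝 (∑ n ∈ Finset.range N, ∫ y, g (S^[n] y) * starRingEnd ℂ (g (S^[n] y)) ∂ν)) := by
  obtain ⟨C, hC⟩ := hgb
  have hgm : ∀ n : ℕ, Measurable fun y => g (S^[n] y) := fun n =>
    hg.comp (hS.measurable.iterate n)
  have hpm : ∀ n m : ℕ, Measurable fun y => g (S^[n] y) * starRingEnd ℂ (g (S^[m] y)) :=
    fun n m => (hgm n).mul (Complex.continuous_conj.measurable.comp (hgm m))
  have hpb : ∀ n m : ℕ, ∀ y, ‖g (S^[n] y) * starRingEnd ℂ (g (S^[m] y))‖ ≤ |C| * |C| := by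
    intro n m y
    rw [norm_mul, RCLike.norm_conj]
    exact mul_le_mul ((hC _).trans (le_abs_self _)) ((hC _).trans (le_abs_self _))
      (norm_nonneg _) (abs_nonneg _)
  -- Each term is an invariant function of the torus times a function of `y`, so it factorizes in
  -- the limit; for n ≠ m the torus factor has frequency k(n - m) ≠ 0 and integral zero.
  have hterm : ∀ n m : ℕ, Tendsto (fun i => ∫ w, fourier (k * n + -(k * m)) w.1.1 *
      (g (S^[n] w.2) * starRingEnd ℂ (g (S^[m] w.2))) ∂ξ i) l
      (𝓝 (if n = m then ∫ y, g (S^[n] y) * starRingEnd ℂ (g (S^[n] y)) ∂ν else 0)) := by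
    intro n m
    have h := hξ.tendsto_integral_mul_of_invariant measurable_skewMap hS
      (h := fun z => fourier (k * n + -(k * m)) z.1)
      (g := fun y => g (S^[n] y) * starRingEnd ℂ (g (S^[m] y)))
      ((measurable_fourier _).comp measurable_fst) ⟨1, fun z => (norm_fourier_apply _ _).le⟩
      (fun _ => rfl) (hpm n m) ⟨_, hpb n m⟩
    rw [integral_torus_fst (measurable_fourier _)] at h
    split_ifs with hnm
    · subst hnm
      simpa using h
    · rw [integral_fourier_eq_zero, zero_mul] at h
      · exact h
      · intro h0
        have : k * ((n : ℤ) - m) = 0 := by linarith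
        rcases mul_eq_zero.1 this with h1 | h1
        · exact hk h1
        · exact hnm (by omega)
  have hsum := tendsto_finsetSum (Finset.range N) fun n _ =>
    tendsto_finsetSum (Finset.range N) fun m _ => hterm n m
  have hrhs : ∑ n ∈ Finset.range N, ∑ m ∈ Finset.range N,
      (if n = m then ∫ y, g (S^[n] y) * starRingEnd ℂ (g (S^[n] y)) ∂ν else 0) =
      ∑ n ∈ Finset.range N, ∫ y, g (S^[n] y) * starRingEnd ℂ (g (S^[n] y)) ∂ν := by
    refine Finset.sum_congr rfl fun n hn => ?_
    rw [Finset.sum_ite_eq, if_pos hn]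
  rw [hrhs] at hsum
  refine hsum.congr fun i => ?_
  have := hξ.isProbabilityMeasure i
  have hint : ∀ n m : ℕ, Integrable (fun w : Torus2 × Y => fourier (k * n + -(k * m)) w.1.1 *
      (g (S^[n] w.2) * starRingEnd ℂ (g (S^[m] w.2)))) (ξ i) := fun n m => by
    refine integrable_of_measurable_of_bounded (((measurable_fourier _).comp
      (measurable_fst.comp measurable_fst)).mul ((hpm n m).comp measurable_snd))
      ⟨|C| * |C|, fun w => ?_⟩
    rw [norm_mul, norm_fourier_apply, one_mul]
    exact hpb n m _
  rw [← Finset.sum_congr rfl fun n _ => integral_finsetSum (Finset.range N) fun m _ => hint n m,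
    ← integral_finsetSum _ fun n _ => integrable_finsetSum _ fun m _ => hint n m]
  refine integral_congr_ae (ae_of_all _ fun w => ?_)
  simp only [map_sum, Finset.sum_mul_sum, map_mul, fourier_add, fourier_neg]
  refine Finset.sum_congr rfl fun n _ => Finset.sum_congr rfl fun m _ => ?_
  ring

/-- A character of the torus that is nontrivial on the invariant circles becomes orthogonal to
every function of an ergodic system. -/
lemma tendsto_integral_character_mul (hξ : IsAsymptoticJoining skewMap volume S ν ξ l)
    (hS : Ergodic S ν) (hg : Measurable g) (hgb : ∃ C : ℝ, ∀ y, ‖g y‖ ≤ C) (j : ℤ) {k : ℤ}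
    (hk : k ≠ 0) :
    Tendsto (fun i => ∫ w, (fourier j w.1.1 * fourier k w.1.2) * g w.2 ∂ξ i) l (𝓝 0) := by
  have hgb' := hgb
  obtain ⟨C, hC⟩ := hgb'
  have hgm : ∀ n : ℕ, Measurable fun y => g (S^[n] y) := fun n =>
    hg.comp (hS.measurable.iterate n)
  have hcm : Measurable fun z : Torus2 => (fourier j z.1 * fourier k z.2 : ℂ) :=
    ((measurable_fourier _).comp measurable_fst).mul ((measurable_fourier _).comp measurable_snd)
  refine tendsto_of_forall_approx fun ε hε => ?_
  -- With this N the diagonal bound N|C|² is below (Nε)², strictly, so that the second moment of `D`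
  -- is eventually below it too.
  obtain ⟨N, hN⟩ := exists_nat_gt (|C| * |C| / ε ^ 2)
  have hNpos : (0 : ℝ) < N :=
    lt_of_le_of_lt (div_nonneg (mul_nonneg (abs_nonneg _) (abs_nonneg _)) (sq_nonneg ε)) hN
  have hN0 : N ≠ 0 := by rintro rfl; simp at hNpos
  set D : Torus2 × Y → ℂ := fun w => ∑ n ∈ Finset.range N, fourier (k * n) w.1.1 * g (S^[n] w.2)
    with hDdef
  have hDm : Measurable D := Finset.measurable_fun_sum _ fun n _ => ((measurable_fourier _).comp
    (measurable_fst.comp measurable_fst)).mul ((hgm n).comp measurable_snd)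
  have hDb : ∀ w, ‖D w‖ ≤ N * |C| := fun w => by
    refine (norm_sum_le_of_le _ (n := fun _ => |C|) fun n _ => ?_).trans (by simp)
    rw [norm_mul, norm_fourier_apply, one_mul]
    exact (hC _).trans (le_abs_self _)
  have hsq := hξ.tendsto_integral_twisted_average_sq hS hg hgb hk N
  have hlim : ‖∑ n ∈ Finset.range N, ∫ y, g (S^[n] y) * starRingEnd ℂ (g (S^[n] y)) ∂ν‖ <
      (N * ε) ^ 2 := by
    have hle : ‖∑ n ∈ Finset.range N, ∫ y, g (S^[n] y) * starRingEnd ℂ (g (S^[n] y)) ∂ν‖ ≤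
        N * (|C| * |C|) := by
      refine (norm_sum_le_of_le _ (n := fun _ => |C| * |C|) fun n _ => ?_).trans
        (le_of_eq (by rw [Finset.sum_const, Finset.card_range, nsmul_eq_mul]))
      refine (norm_integral_le_of_norm_le_const (C := |C| * |C|)
        (ae_of_all _ fun y => ?_)).trans (by simp)
      rw [norm_mul, RCLike.norm_conj]
      exact mul_le_mul ((hC _).trans (le_abs_self _)) ((hC _).trans (le_abs_self _))
        (norm_nonneg _) (abs_nonneg _)
    rw [div_lt_iff₀ (by positivity)] at hN
    calc _ ≤ N * (|C| * |C|) := hle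
      _ < N * (N * ε ^ 2) := by gcongr
      _ = (N * ε) ^ 2 := by ring
  refine ⟨_, hξ.tendsto_average_sub (Φ := fun w => (fourier j w.1.1 * fourier k w.1.2) * g w.2)
    measurable_skewMap hS.measurable ((hcm.comp measurable_fst).mul (hg.comp measurable_snd))
    ⟨C, fun w => ?_⟩ hN0, ?_⟩
  · rw [norm_mul, norm_mul, norm_fourier_apply, norm_fourier_apply, one_mul, one_mul]
    exact hC _
  filter_upwards [hsq.norm.eventually (gt_mem_nhds hlim)] with i hi
  have := hξ.isProbabilityMeasure i
  have hDint : Integrable (fun w => ‖D w‖ ^ 2) (ξ i) := by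
    refine Integrable.of_bound (hDm.norm.pow_const 2).aestronglyMeasurable ((N * |C|) ^ 2)
      (ae_of_all _ fun w => ?_)
    rw [Real.norm_eq_abs, abs_of_nonneg (by positivity)]
    exact pow_le_pow_left₀ (norm_nonneg _) (hDb w) 2
  have hDsq : ∫ w, ‖D w‖ ^ 2 ∂ξ i ≤ (N * ε) ^ 2 := by
    have h1 : ∫ w, D w * starRingEnd ℂ (D w) ∂ξ i = ((∫ w, ‖D w‖ ^ 2 ∂ξ i : ℝ) : ℂ) := by
      refine Eq.trans (integral_congr_ae (ae_of_all _ fun w => ?_)) integral_complex_ofReal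
      simp only [Complex.mul_conj, Complex.normSq_eq_norm_sq]
    have h2 : ‖∫ w, D w * starRingEnd ℂ (D w) ∂ξ i‖ < (N * ε) ^ 2 := hi
    rw [h1, Complex.norm_real] at h2
    exact (le_abs_self _).trans h2.le
  rw [sub_zero]
  -- The inequality 2‖D‖ ≤ Nε + ‖D‖²/(Nε) takes the place of Cauchy-Schwarz; after integration both
  -- terms on the right are at most Nε.
  have hbound : ∀ w : Torus2 × Y, ‖(N : ℂ)⁻¹ * ∑ n ∈ Finset.range N,
      (fourier j (skewMap^[n] w.1).1 * fourier k (skewMap^[n] w.1).2) * g (S^[n] w.2)‖ ≤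
      (N : ℝ)⁻¹ * ((N * ε + (N * ε)⁻¹ * ‖D w‖ ^ 2) / 2) := by
    intro w
    have heq : ∑ n ∈ Finset.range N,
        (fourier j (skewMap^[n] w.1).1 * fourier k (skewMap^[n] w.1).2) * g (S^[n] w.2) =
        (fourier j w.1.1 * fourier k w.1.2) * D w := by
      rw [hDdef, Finset.mul_sum]
      refine Finset.sum_congr rfl fun n _ => ?_
      rw [skewMap_iterate, fourier_add_nsmul]
      ring
    rw [heq, norm_mul, norm_mul, norm_mul, norm_fourier_apply, norm_fourier_apply, norm_inv,
      Complex.norm_natCast, one_mul, one_mul]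
    refine mul_le_mul_of_nonneg_left ?_ (by positivity)
    have hNε : 0 < N * ε := by positivity
    have h3 : 0 ≤ (N * ε)⁻¹ * (N * ε - ‖D w‖) ^ 2 := by positivity
    have h4 : (N * ε)⁻¹ * (N * ε - ‖D w‖) ^ 2 =
        N * ε + (N * ε)⁻¹ * ‖D w‖ ^ 2 - 2 * ‖D w‖ := by
      field_simp
      ring
    linarith
  refine (norm_integral_le_of_norm_le ?_ (ae_of_all _ hbound)).trans ?_
  · exact (((integrable_const _).add (hDint.const_mul _)).div_const 2).const_mul _
  · rw [integral_const_mul, integral_div, integral_add (integrable_const _) (hDint.const_mul _),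
      integral_const, integral_const_mul, probReal_univ, one_smul]
    have hNε : 0 < N * ε := by positivity
    calc (N : ℝ)⁻¹ * ((N * ε + (N * ε)⁻¹ * ∫ w, ‖D w‖ ^ 2 ∂ξ i) / 2)
        ≤ (N : ℝ)⁻¹ * ((N * ε + (N * ε)⁻¹ * (N * ε) ^ 2) / 2) := by gcongr
      _ = ε := by field_simp; ring

end IsAsymptoticJoining

/-! ### From characters to bounded measurable functions. -/

namespace IsAsymptoticJoining

section Approximation

variable {ι X Y : Type*} [MeasurableSpace X] [MeasurableSpace Y] {T : X → X} {μ : Measure X}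
  {S : Y → Y} {ν : Measure Y} {ξ : ι → Measure (X × Y)} {l : Filter ι}

/-- The cost of replacing `f` by `q` is uniform in `i`, since every `ξ i` has first marginal exactly
μ. -/
lemma tendsto_integral_mul_of_approx [IsProbabilityMeasure μ] [IsProbabilityMeasure ν]
    (hξ : IsAsymptoticJoining T μ S ν ξ l) {f : X → ℂ} {g : Y → ℂ} (hf : Measurable f)
    (hfb : ∃ C : ℝ, ∀ x, ‖f x‖ ≤ C) (hg : Measurable g) (hgb : ∃ C : ℝ, ∀ y, ‖g y‖ ≤ C)
    (h : ∀ ε : ℝ, 0 < ε → ∃ q : X → ℂ, Measurable q ∧ (∃ C : ℝ, ∀ x, ‖q x‖ ≤ C) ∧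
      ∫ x, ‖f x - q x‖ ∂μ ≤ ε ∧
      Tendsto (fun i => ∫ w, q w.1 * g w.2 ∂ξ i) l (𝓝 ((∫ x, q x ∂μ) * ∫ y, g y ∂ν))) :
    Tendsto (fun i => ∫ w, f w.1 * g w.2 ∂ξ i) l (𝓝 ((∫ x, f x ∂μ) * ∫ y, g y ∂ν)) := by
  obtain ⟨C, hC⟩ := hfb
  obtain ⟨D, hD⟩ := hgb
  rw [Metric.tendsto_nhds]
  intro ε hε
  -- Three errors of at most ε/4 each arise below; the added 1 covers D = 0.
  have hδ : 0 < ε / (4 * (|D| + 1)) := by positivity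
  obtain ⟨q, hq, ⟨B, hB⟩, hfq, hlim⟩ := h _ hδ
  rw [Metric.tendsto_nhds] at hlim
  filter_upwards [hlim (ε / 4) (by positivity)] with i hi
  have := hξ.isProbabilityMeasure i
  have hfi : Integrable f μ := integrable_of_measurable_of_bounded hf ⟨C, hC⟩
  have hqi : Integrable q μ := integrable_of_measurable_of_bounded hq ⟨B, hB⟩
  have hprod : ∀ {p : X → ℂ}, Measurable p → (∃ A : ℝ, ∀ x, ‖p x‖ ≤ A) →
      Integrable (fun w : X × Y => p w.1 * g w.2) (ξ i) := by
    rintro p hp ⟨A, hA⟩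
    refine integrable_of_measurable_of_bounded
      ((hp.comp measurable_fst).mul (hg.comp measurable_snd)) ⟨|A| * |D|, fun w => ?_⟩
    rw [norm_mul]
    exact mul_le_mul ((hA _).trans (le_abs_self _)) ((hD _).trans (le_abs_self _))
      (norm_nonneg _) (abs_nonneg _)
  have h1 : ‖∫ w, f w.1 * g w.2 ∂ξ i - ∫ w, q w.1 * g w.2 ∂ξ i‖ ≤ ε / 4 := by
    rw [← integral_sub (hprod hf ⟨C, hC⟩) (hprod hq ⟨B, hB⟩)]
    have hle : ‖∫ w, (f w.1 * g w.2 - q w.1 * g w.2) ∂ξ i‖ ≤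
        ∫ w, ‖f w.1 - q w.1‖ * |D| ∂ξ i := by
      refine norm_integral_le_of_norm_le ?_ (ae_of_all _ fun w => ?_)
      · exact ((integrable_of_measurable_of_bounded
          ((hf.comp measurable_fst).sub (hq.comp measurable_fst))
          ⟨C + B, fun w => (norm_sub_le _ _).trans (add_le_add (hC _) (hB _))⟩).norm).mul_const _
      · rw [← sub_mul, norm_mul]
        gcongr
        exact (hD _).trans (le_abs_self _)
    refine hle.trans ?_
    rw [integral_mul_const, hξ.integral_fst i (f := fun x => ‖f x - q x‖)
      (hf.sub hq).norm.aestronglyMeasurable]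
    calc (∫ x, ‖f x - q x‖ ∂μ) * |D| ≤ ε / (4 * (|D| + 1)) * (|D| + 1) := by gcongr; linarith
      _ = ε / 4 := by field_simp
  have h2 : ‖(∫ x, q x ∂μ) * (∫ y, g y ∂ν) - (∫ x, f x ∂μ) * ∫ y, g y ∂ν‖ ≤ ε / 4 := by
    rw [← sub_mul, ← integral_sub hqi hfi, norm_mul]
    have h3 : ‖∫ x, (q x - f x) ∂μ‖ ≤ ε / (4 * (|D| + 1)) := by
      refine (norm_integral_le_integral_norm _).trans (le_trans (le_of_eq ?_) hfq)
      exact integral_congr_ae (ae_of_all _ fun x => norm_sub_rev _ _)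
    have h4 : ‖∫ y, g y ∂ν‖ ≤ |D| + 1 := by
      refine (norm_integral_le_of_norm_le_const (ae_of_all _ hD)).trans ?_
      simp only [probReal_univ, mul_one]
      linarith [le_abs_self D]
    calc _ ≤ ε / (4 * (|D| + 1)) * (|D| + 1) :=
          mul_le_mul h3 h4 (norm_nonneg _) hδ.le
      _ = ε / 4 := by field_simp
  rw [dist_eq_norm] at hi ⊢
  have hsplit : ∫ w, f w.1 * g w.2 ∂ξ i - (∫ x, f x ∂μ) * ∫ y, g y ∂ν =
      (∫ w, f w.1 * g w.2 ∂ξ i - ∫ w, q w.1 * g w.2 ∂ξ i) +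
      (∫ w, q w.1 * g w.2 ∂ξ i - (∫ x, q x ∂μ) * ∫ y, g y ∂ν) +
      ((∫ x, q x ∂μ) * (∫ y, g y ∂ν) - (∫ x, f x ∂μ) * ∫ y, g y ∂ν) := by ring
  rw [hsplit]
  refine (norm_add₃_le).trans_lt ?_
  linarith

end Approximation

variable {ι Y : Type*} [MeasurableSpace Y] {S : Y → Y} {ν : Measure Y} [IsProbabilityMeasure ν]
  {ξ : ι → Measure (Torus2 × Y)} {l : Filter ι} {g : Y → ℂ}

lemma tendsto_integral_fourier_mul_fourier (hξ : IsAsymptoticJoining skewMap volume S ν ξ l)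
    (hS : Ergodic S ν) (hg : Measurable g) (hgb : ∃ C : ℝ, ∀ y, ‖g y‖ ≤ C) (j k : ℤ) :
    Tendsto (fun i => ∫ w, (fourier j w.1.1 * fourier k w.1.2) * g w.2 ∂ξ i) l
      (𝓝 ((∫ z : Torus2, (fourier j z.1 * fourier k z.2 : ℂ)) * ∫ y, g y ∂ν)) := by
  rcases eq_or_ne k 0 with rfl | hk
  · simpa using hξ.tendsto_integral_mul_of_invariant measurable_skewMap hS
      (h := fun z => fourier j z.1) ((measurable_fourier _).comp measurable_fst)
      ⟨1, fun z => (norm_fourier_apply _ _).le⟩ (fun _ => rfl) hg hgb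
  · have h0 : ∫ z : Torus2, (fourier j z.1 * fourier k z.2 : ℂ) = 0 := by
      rw [Measure.volume_eq_prod, integral_prod_mul (fun t => (fourier j t : ℂ))
        (fun s => (fourier k s : ℂ)), integral_fourier_eq_zero hk, mul_zero]
    rw [h0, zero_mul]
    exact hξ.tendsto_integral_character_mul hS hg hgb j hk

lemma tendsto_integral_mul_of_mem_span (hξ : IsAsymptoticJoining skewMap volume S ν ξ l)
    (hS : Ergodic S ν) (hg : Measurable g) (hgb : ∃ C : ℝ, ∀ y, ‖g y‖ ≤ C)
    {q : C(UnitAddTorus (Fin 2), ℂ)}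
    (hq : q ∈ Submodule.span ℂ (Set.range (UnitAddTorus.mFourier (d := Fin 2)))) :
    Tendsto (fun i => ∫ w, q ![w.1.1, w.1.2] * g w.2 ∂ξ i) l
      (𝓝 ((∫ z : Torus2, q ![z.1, z.2]) * ∫ y, g y ∂ν)) := by
  have hcont : ∀ p : C(UnitAddTorus (Fin 2), ℂ), Continuous fun z : Torus2 => p ![z.1, z.2] :=
    fun p => p.continuous.comp (by fun_prop)
  have hpi : ∀ p : C(UnitAddTorus (Fin 2), ℂ), Integrable fun z : Torus2 => p ![z.1, z.2] :=
    fun p => integrable_of_measurable_of_bounded (hcont p).measurable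
      ⟨‖p‖, fun z => p.norm_coe_le_norm _⟩
  have hpg : ∀ (p : C(UnitAddTorus (Fin 2), ℂ)) (i : ι),
      Integrable (fun w : Torus2 × Y => p ![w.1.1, w.1.2] * g w.2) (ξ i) := by
    intro p i
    obtain ⟨D, hD⟩ := hgb
    have := hξ.isProbabilityMeasure i
    refine integrable_of_measurable_of_bounded (((hcont p).measurable.comp measurable_fst).mul
      (hg.comp measurable_snd)) ⟨‖p‖ * |D|, fun w => ?_⟩
    rw [norm_mul]
    exact mul_le_mul (p.norm_coe_le_norm _) ((hD _).trans (le_abs_self _))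
      (norm_nonneg _) (norm_nonneg _)
  induction hq using Submodule.span_induction with
  | mem x hx =>
    obtain ⟨n, rfl⟩ := hx
    simpa [UnitAddTorus.mFourier] using
      hξ.tendsto_integral_fourier_mul_fourier hS hg hgb (n 0) (n 1)
  | zero => simpa using tendsto_const_nhds
  | add x y _ _ hx hy =>
    have h := hx.add hy
    rw [← add_mul, ← integral_add (hpi x) (hpi y)] at h
    refine h.congr fun i => ?_
    rw [← integral_add (hpg x i) (hpg y i)]
    simp [add_mul]
  | smul c x _ hx =>
    have h := hx.const_mul c
    have he : ∫ z : Torus2, (c • x) ![z.1, z.2] = c * ∫ z : Torus2, x ![z.1, z.2] := by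
      rw [← integral_const_mul]
      rfl
    rw [he, mul_assoc]
    refine h.congr fun i => ?_
    rw [← integral_const_mul]
    simp [mul_assoc]

/-- Every bounded measurable function on the torus becomes independent of an ergodic system. -/
theorem tendsto_integral_mul (hξ : IsAsymptoticJoining skewMap volume S ν ξ l)
    (hS : Ergodic S ν) {f : Torus2 → ℂ} (hf : Measurable f) (hfb : ∃ C : ℝ, ∀ z, ‖f z‖ ≤ C)
    (hg : Measurable g) (hgb : ∃ C : ℝ, ∀ y, ‖g y‖ ≤ C) :
    Tendsto (fun i => ∫ w, f w.1 * g w.2 ∂ξ i) l (𝓝 ((∫ z, f z) * ∫ y, g y ∂ν)) := by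
  refine hξ.tendsto_integral_mul_of_approx hf hfb hg hgb fun ε hε => ?_
  -- Two approximations: by a bounded continuous function in L¹, then by a trigonometric polynomial
  -- uniformly. `r` is `q` carried over to the torus indexed by `Fin 2`, where the characters have
  -- dense span.
  obtain ⟨q, hfq, -⟩ := (integrable_of_measurable_of_bounded (μ := (volume : Measure Torus2)) hf
    hfb).exists_boundedContinuous_integral_sub_le hε
  refine ⟨q, q.continuous.measurable, ⟨‖q‖, q.norm_coe_le_norm⟩, hfq, ?_⟩
  refine hξ.tendsto_integral_mul_of_approx q.continuous.measurable ⟨‖q‖, q.norm_coe_le_norm⟩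
    hg hgb fun δ hδ => ?_
  let r : C(UnitAddTorus (Fin 2), ℂ) := ⟨fun x => q (x 0, x 1), by fun_prop⟩
  have hr : r ∈ (Submodule.span ℂ
      (Set.range (UnitAddTorus.mFourier (d := Fin 2)))).topologicalClosure := by
    rw [UnitAddTorus.span_mFourier_closure_eq_top]
    trivial
  obtain ⟨p, hp, hrp⟩ := Metric.mem_closure_iff.1 hr δ hδ
  have hpc : Continuous fun z : Torus2 => p ![z.1, z.2] := p.continuous.comp (by fun_prop)
  refine ⟨fun z => p ![z.1, z.2], hpc.measurable, ⟨‖p‖, fun z => p.norm_coe_le_norm _⟩, ?_,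
    hξ.tendsto_integral_mul_of_mem_span hS hg hgb hp⟩
  have hle : ∀ z : Torus2, ‖q z - p ![z.1, z.2]‖ ≤ δ := fun z => by
    rw [dist_eq_norm] at hrp
    exact ((r - p).norm_coe_le_norm ![z.1, z.2]).trans hrp.le
  calc ∫ z, ‖q z - p ![z.1, z.2]‖ ≤ ∫ _ : Torus2, δ :=
        integral_mono_of_nonneg (ae_of_all _ fun _ => norm_nonneg _) (integrable_const _)
          (ae_of_all _ hle)
    _ = δ := by simp

end IsAsymptoticJoining

/-! ### Disjointness of the skew map. -/

lemma IsJoining.isAsymptoticJoining {X Y : Type*} [MeasurableSpace X] [MeasurableSpace Y]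
    {T : X → X} {μ : Measure X} {S : Y → Y} {ν : Measure Y} {ξ : Measure (X × Y)}
    (hξ : IsJoining T μ S ν ξ) :
    IsAsymptoticJoining T μ S ν (fun _ : ℕ => ξ) atTop where
  map_fst _ := hξ.map_fst
  map_snd _ := hξ.map_snd
  tendsto_comp_sub Φ hΦ _ := by
    have h : ∫ w, Φ (Prod.map T S w) ∂ξ = ∫ w, Φ w ∂ξ := by
      conv_rhs => rw [← hξ.invariant.map_eq]
      rw [integral_map hξ.invariant.measurable.aemeasurable hΦ.aestronglyMeasurable]
    simp [h]

/-- The Lebesgue measure on the torus is disjoint from every ergodic system. -/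
theorem furstenbergDisjoint_skewMap {Y : Type*} [MeasurableSpace Y] {S : Y → Y} {ν : Measure Y}
    [IsProbabilityMeasure ν] (hS : Ergodic S ν) :
    FurstenbergDisjoint skewMap (volume : Measure Torus2) S ν := by
  intro ξ hξ f g hf hg hfb hgb
  exact tendsto_nhds_unique tendsto_const_nhds
    (hξ.isAsymptoticJoining.tendsto_integral_mul hS hf hfb hg hgb)

/-! ### Cesàro averages of couplings. -/

section Cesaro

variable {X Y : Type*} [MeasurableSpace X] [MeasurableSpace Y] {T : X → X} {μ : Measure X}
  {S : Y → Y} {ν : Measure Y}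

/-- The averages of the first `M + 1` images of `ξ` under the iterates of `R`. -/
noncomputable def cesaroMeasure (R : X → X) (ξ : Measure X) (M : ℕ) : Measure X :=
  ((M + 1 : ℕ) : ENNReal)⁻¹ • ∑ m ∈ Finset.range (M + 1), ξ.map R^[m]

/-- The M + 1 weights sum to 1. This serves twice: for the marginals of the averages, and for their
projection to a joining of a factor. -/
lemma map_cesaroMeasure {R : X → X} {ξ : Measure X} {p : X → Y} (hR : Measurable R)
    (hp : Measurable p) {ρ : Measure Y} (h : ∀ m : ℕ, ξ.map (p ∘ R^[m]) = ρ) (M : ℕ) :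
    (cesaroMeasure R ξ M).map p = ρ := by
  ext E hE
  have hm : ∀ m : ℕ, ξ.map R^[m] (p ⁻¹' E) = ρ E := fun m => by
    rw [← h m, ← Measure.map_map hp (hR.iterate m), Measure.map_apply hp hE]
  rw [Measure.map_apply hp hE, cesaroMeasure, Measure.smul_apply, Measure.finsetSum_apply,
    Finset.sum_congr rfl fun m _ => hm m, Finset.sum_const, Finset.card_range, nsmul_eq_mul,
    smul_eq_mul, ← mul_assoc, ENNReal.inv_mul_cancel (by simp) (ENNReal.natCast_ne_top _), one_mul]

lemma integral_cesaroMeasure {R : X → X} {ξ : Measure X} [IsFiniteMeasure ξ] (hR : Measurable R)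
    {Φ : X → ℂ} (hΦ : Measurable Φ) (hb : ∃ C : ℝ, ∀ x, ‖Φ x‖ ≤ C) (M : ℕ) :
    ∫ x, Φ x ∂cesaroMeasure R ξ M =
      ((M + 1 : ℕ) : ℂ)⁻¹ * ∑ m ∈ Finset.range (M + 1), ∫ x, Φ (R^[m] x) ∂ξ := by
  rw [cesaroMeasure, integral_smul_measure, integral_finsetSum_measure fun m _ =>
    integrable_of_measurable_of_bounded hΦ hb, ENNReal.toReal_inv, ENNReal.toReal_natCast,
    Complex.real_smul]
  push_cast
  congr 1
  exact Finset.sum_congr rfl fun m _ =>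
    integral_map (hR.iterate m).aemeasurable hΦ.aestronglyMeasurable

/-- The averages of the images of a coupling form an asymptotic joining. -/
lemma isAsymptoticJoining_cesaroMeasure [IsProbabilityMeasure ν] (hT : MeasurePreserving T μ μ)
    (hS : MeasurePreserving S ν ν) {ξ : Measure (X × Y)} (hfst : ξ.map Prod.fst = μ)
    (hsnd : ξ.map Prod.snd = ν) :
    IsAsymptoticJoining T μ S ν (cesaroMeasure (Prod.map T S) ξ) atTop where
  map_fst M := by
    refine map_cesaroMeasure (hT.measurable.prodMap hS.measurable) measurable_fst (fun m => ?_) M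
    have : Prod.fst ∘ (Prod.map T S)^[m] = T^[m] ∘ Prod.fst := by
      rw [Prod.map_iterate]
      rfl
    rw [this, ← Measure.map_map (hT.measurable.iterate m) measurable_fst, hfst,
      (hT.iterate m).map_eq]
  map_snd M := by
    refine map_cesaroMeasure (hT.measurable.prodMap hS.measurable) measurable_snd (fun m => ?_) M
    have : Prod.snd ∘ (Prod.map T S)^[m] = S^[m] ∘ Prod.snd := by
      rw [Prod.map_iterate]
      rfl
    rw [this, ← Measure.map_map (hS.measurable.iterate m) measurable_snd, hsnd,
      (hS.iterate m).map_eq]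
  tendsto_comp_sub Φ hΦ hb := by
    obtain ⟨C, hC⟩ := hb
    have hprob : IsProbabilityMeasure ξ := by
      constructor
      have h1 : ξ.map Prod.snd Set.univ = 1 := by rw [hsnd]; exact measure_univ
      rwa [Measure.map_apply measurable_snd MeasurableSet.univ, Set.preimage_univ] at h1
    have hR : Measurable (Prod.map T S) := hT.measurable.prodMap hS.measurable
    have hlim : Tendsto (fun M : ℕ => 2 * C * ((M : ℝ) + 1)⁻¹) atTop (𝓝 0) := by
      simpa [one_div] using tendsto_one_div_add_atTop_nhds_zero_nat.const_mul (2 * C)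
    refine squeeze_zero_norm (fun M => ?_) hlim
    rw [integral_cesaroMeasure (Φ := fun w => Φ (Prod.map T S w)) hR (hΦ.comp hR)
        ⟨C, fun w => hC _⟩ M,
      integral_cesaroMeasure hR hΦ ⟨C, hC⟩ M, ← mul_sub, ← Finset.sum_sub_distrib]
    -- The sum telescopes to two boundary terms of norm at most C, which gives the bound 2C/(M + 1).
    have htel : ∑ m ∈ Finset.range (M + 1), (∫ w, Φ (Prod.map T S ((Prod.map T S)^[m] w)) ∂ξ -
        ∫ w, Φ ((Prod.map T S)^[m] w) ∂ξ) =
        ∫ w, Φ ((Prod.map T S)^[M + 1] w) ∂ξ - ∫ w, Φ ((Prod.map T S)^[0] w) ∂ξ := by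
      rw [← Finset.sum_range_sub fun m => ∫ w, Φ ((Prod.map T S)^[m] w) ∂ξ]
      simp only [Function.iterate_succ_apply']
    have hle : ∀ m : ℕ, ‖∫ w, Φ ((Prod.map T S)^[m] w) ∂ξ‖ ≤ C := fun m =>
      (norm_integral_le_of_norm_le_const (ae_of_all _ fun w => hC _)).trans (by simp)
    have htel' := congrArg norm htel
    rw [norm_mul, norm_inv, Complex.norm_natCast, mul_comm]
    push_cast
    gcongr
    refine htel'.trans_le ((norm_sub_le _ _).trans ?_)
    linarith [hle (M + 1), hle 0]

end Cesaro

/-! ### Lifting couplings through a factor map. -/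

section Lift

open ProbabilityTheory

variable {X Y Z : Type*} [MeasurableSpace X] [MeasurableSpace Y] [MeasurableSpace Z]

/-- A coupling of an image of `μ` with another measure lifts to a coupling of `μ`. -/
lemma exists_lift_coupling [StandardBorelSpace X] [Nonempty X] [MeasurableEq Z] {μ : Measure X}
    [IsProbabilityMeasure μ] {p : X → Z} (hp : Measurable p) {η : Measure (Z × Y)}
    (hη : η.map Prod.fst = μ.map p) :
    ∃ ξ : Measure (X × Y), ξ.map Prod.fst = μ ∧ ξ.map (Prod.map p id) = η := by
  have hpg : Measurable fun x => (p x, x) := hp.prodMk measurable_id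
  set ρ : Measure (Z × X) := μ.map fun x => (p x, x) with hρ
  have : IsProbabilityMeasure ρ := Measure.isProbabilityMeasure_map hpg.aemeasurable
  have : IsProbabilityMeasure η := by
    constructor
    have h1 : η.map Prod.fst Set.univ = 1 := by
      rw [hη, Measure.map_apply hp MeasurableSet.univ, Set.preimage_univ, measure_univ]
    rwa [Measure.map_apply measurable_fst MeasurableSet.univ, Set.preimage_univ] at h1
  have hρfst : ρ.fst = η.map Prod.fst := by
    rw [hη, Measure.fst, hρ, Measure.map_map measurable_fst hpg]
    rfl
  -- Given (z, y), the point x is drawn from its conditional law given p x = z, independently of y.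
  set ζ : Measure ((Z × Y) × X) := η ⊗ₘ (ρ.condKernel.comap Prod.fst measurable_fst) with hζ
  have hq : Measurable fun w : (Z × Y) × X => (w.1.1, w.2) :=
    (measurable_fst.comp measurable_fst).prodMk measurable_snd
  have hmapρ : ζ.map (fun w => (w.1.1, w.2)) = ρ := by
    ext E hE
    rw [Measure.map_apply hq hE, hζ, Measure.compProd_apply (hq hE)]
    conv_rhs => rw [← ρ.disintegrate ρ.condKernel, Measure.compProd_apply hE, hρfst]
    rw [lintegral_map (Kernel.measurable_kernel_prodMk_left hE) measurable_fst]
    rfl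
  -- `ρ` is carried by the graph of `p`, and the (z, x)-marginal of `ζ` is `ρ`.
  have hgraph : ∀ᵐ w ∂ζ, p w.2 = w.1.1 := by
    have h1 : ∀ᵐ v ∂ρ, p v.2 = v.1 :=
      (ae_map_iff hpg.aemeasurable (measurableSet_eq_fun (hp.comp measurable_snd)
        measurable_fst)).2 (ae_of_all _ fun x => rfl)
    rw [← hmapρ] at h1
    exact ae_of_ae_map hq.aemeasurable h1
  have hr : Measurable fun w : (Z × Y) × X => (w.2, w.1.2) :=
    measurable_snd.prodMk (measurable_snd.comp measurable_fst)
  refine ⟨ζ.map fun w => (w.2, w.1.2), ?_, ?_⟩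
  · rw [Measure.map_map measurable_fst hr]
    have h1 : ζ.map (Prod.fst ∘ fun w => (w.2, w.1.2)) = ρ.map Prod.snd := by
      rw [← hmapρ, Measure.map_map measurable_snd hq]
      rfl
    rw [h1, hρ, Measure.map_map measurable_snd hpg]
    exact Measure.map_id
  · rw [Measure.map_map (hp.prodMap measurable_id) hr]
    have h1 : (Prod.map p id ∘ fun w : (Z × Y) × X => (w.2, w.1.2)) =ᵐ[ζ] Prod.fst := by
      filter_upwards [hgraph] with w hw
      exact Prod.ext hw rfl
    rw [Measure.map_congr h1]
    exact Measure.fst_compProd _ _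

end Lift

/-! ### Disjointness of the factors. -/

/-- Every factor of the skew map is disjoint from every ergodic system. -/
theorem furstenbergDisjoint_of_semiconj_skewMap {Y Z : Type*} [MeasurableSpace Y]
    [MeasurableSpace Z] [MeasurableEq Z] {S : Y → Y} {ν : Measure Y} [IsProbabilityMeasure ν]
    (hS : Ergodic S ν) {p : Torus2 → Z} {R : Z → Z} (hp : Measurable p)
    (hpR : Function.Semiconj p skewMap R) :
    FurstenbergDisjoint R ((volume : Measure Torus2).map p) S ν := by
  intro η hη f g hf hg hfb hgb
  obtain ⟨ξ, hfst, hξη⟩ := exists_lift_coupling hp hη.map_fst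
  have hpid : Measurable (Prod.map p (id : Y → Y)) := hp.prodMap measurable_id
  have hsnd : ξ.map Prod.snd = ν := by
    rw [← hη.map_snd, ← hξη, Measure.map_map measurable_snd hpid]
    rfl
  have hprob : IsProbabilityMeasure ξ := by
    constructor
    have h1 : ξ.map Prod.fst Set.univ = 1 := by rw [hfst]; exact measure_univ
    rwa [Measure.map_apply measurable_fst MeasurableSet.univ, Set.preimage_univ] at h1
  have hfp : Measurable fun z => f (p z) := hf.comp hp
  have hlim := (isAsymptoticJoining_cesaroMeasure measurePreserving_skewMap hS.toMeasurePreserving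
    hfst hsnd).tendsto_integral_mul hS hfp ⟨hfb.choose, fun z => hfb.choose_spec _⟩ hg hgb
  have hsemi : Function.Semiconj (Prod.map p id) (Prod.map skewMap S) (Prod.map R S) :=
    fun w => Prod.ext (hpR w.1) rfl
  -- Each Cesàro average projects to `η` because `η` is invariant, so the sequence of integrals is
  -- constant and equals its limit.
  have hconst : ∀ M : ℕ, ∫ w, f (p w.1) * g w.2 ∂cesaroMeasure (Prod.map skewMap S) ξ M =
      ∫ z, f z.1 * g z.2 ∂η := by
    intro M
    have hsk := measurable_skewMap.prodMap hS.measurable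
    have hmap : (cesaroMeasure (Prod.map skewMap S) ξ M).map (Prod.map p id) = η := by
      refine map_cesaroMeasure hsk hpid (fun m => ?_) M
      rw [(hsemi.iterate_right m).comp_eq,
        ← Measure.map_map (hη.invariant.measurable.iterate m) hpid, hξη,
        (hη.invariant.iterate m).map_eq]
    conv_rhs => rw [← hmap]
    exact (integral_map hpid.aemeasurable
      ((hf.comp measurable_fst).mul (hg.comp measurable_snd)).aestronglyMeasurable).symm
  simp only [hconst] at hlim
  rw [integral_map hp.aemeasurable hf.aestronglyMeasurable]
  exact tendsto_nhds_unique tendsto_const_nhds hlim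

/-! ### Ergodic circles and nontrivial partitions. -/

instance : NullSingletonClass (volume : Measure UnitAddCircle) :=
  ⟨fun x => by rw [← Metric.closedBall_zero, AddCircle.volume_closedBall]; simp⟩

/-- A rotation by an element of infinite order is ergodic, and the torsion elements form a countable
union of finite sets. -/
lemma ae_ergodic_circleRotation :
    ∀ᵐ t : UnitAddCircle, Ergodic (circleRotation t) (volume : Measure UnitAddCircle) := by
  have h : ∀ᵐ t : UnitAddCircle, ∀ n : ℕ, 0 < n → n • t ≠ 0 := by
    refine ae_all_iff.2 fun n => ?_
    by_cases hn : 0 < n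
    · have hz : volume {t : UnitAddCircle | n • t = 0} = 0 :=
        (AddCircle.finite_torsion (1 : ℝ) hn).measure_zero volume
      filter_upwards [measure_eq_zero_iff_ae_notMem.1 hz] with t ht _
      exact ht
    · exact ae_of_all _ fun t h => absurd h hn
  filter_upwards [h] with t ht
  refine AddCircle.ergodic_add_right.2 (addOrderOf_eq_zero_iff'.2 fun n hn => ht n hn)

/-- Cutting every circle along the same arc of length 1/2 works for all `t`. -/
lemma exists_nontrivialOnErgodicCircles {K : Finset ℂ} (hK : 2 ≤ K.card) :
    ∃ P : Torus2 → K, Measurable P ∧ NontrivialOnErgodicCircles P := by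
  classical
  obtain ⟨a, ha, b, hb, hab⟩ := Finset.one_lt_card.1 hK
  have hE : MeasurableSet (Metric.closedBall (0 : UnitAddCircle) (1 / 4)) :=
    Metric.isClosed_closedBall.measurableSet
  have hvol : volume (Metric.closedBall (0 : UnitAddCircle) (1 / 4)) = ENNReal.ofReal (1 / 2) := by
    rw [AddCircle.volume_closedBall]
    norm_num
  refine ⟨fun z => if z.2 ∈ Metric.closedBall (0 : UnitAddCircle) (1 / 4) then ⟨a, ha⟩
    else ⟨b, hb⟩, Measurable.ite (measurable_snd hE) measurable_const measurable_const, ?_⟩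
  intro t _ c hc
  -- A label other than `a`, including one that is never used, can occur only off the arc.
  have hball : (∀ᵐ s : UnitAddCircle, s ∈ Metric.closedBall (0 : UnitAddCircle) (1 / 4)) ∨
      ∀ᵐ s : UnitAddCircle, s ∈ (Metric.closedBall (0 : UnitAddCircle) (1 / 4))ᶜ := by
    by_cases hca : c = ⟨a, ha⟩
    · left
      filter_upwards [hc] with s hs
      by_contra hn
      rw [if_neg hn, hca] at hs
      exact hab (congrArg Subtype.val hs).symm
    · right
      filter_upwards [hc] with s hs hn
      rw [if_pos hn] at hs
      exact hca hs.symm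
  rcases hball with h | h
  · have h1 := (prob_compl_eq_zero_iff hE).1 (mem_ae_iff.1 h)
    rw [hvol] at h1
    norm_num at h1
  · have h1 := measure_eq_zero_iff_ae_notMem.2 h
    rw [hvol] at h1
    norm_num at h1

/-! ### The symbolic factor and its components. -/

section Itinerary

variable {K : Finset ℂ} {P : Torus2 → K}

lemma measurable_itinerary (hP : Measurable P) : Measurable (itinerary P) :=
  measurable_pi_lambda _ fun n => hP.comp (measurable_skewMap.iterate n)

lemma measurable_shift : Measurable (shift : (ℕ → K) → ℕ → K) :=
  measurable_pi_lambda _ fun n => measurable_pi_apply (n + 1)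

lemma semiconj_itinerary (P : Torus2 → K) : Function.Semiconj (itinerary P) skewMap shift :=
  fun z => funext fun n => congrArg P (Function.iterate_succ_apply skewMap n z).symm

lemma measurePreserving_itinerary (hP : Measurable P) :
    MeasurePreserving (itinerary P) (volume : Measure Torus2) (symbolicFactor P) :=
  ⟨measurable_itinerary hP, rfl⟩

lemma isProbabilityMeasure_symbolicFactor (hP : Measurable P) :
    IsProbabilityMeasure (symbolicFactor P) :=
  Measure.isProbabilityMeasure_map (measurable_itinerary hP).aemeasurable

lemma measurePreserving_shift_symbolicFactor (hP : Measurable P) :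
    MeasurePreserving shift (symbolicFactor P) (symbolicFactor P) :=
  (measurePreserving_itinerary hP).of_semiconj measurePreserving_skewMap (semiconj_itinerary P)
    measurable_shift

lemma measurable_itinerary_circle (hP : Measurable P) (t : UnitAddCircle) :
    Measurable fun s => itinerary P (t, s) :=
  (measurable_itinerary hP).comp measurable_prodMk_left

lemma symbolicFactor_apply (hP : Measurable P) {E : Set (ℕ → K)} (hE : MeasurableSet E) :
    symbolicFactor P E = ∫⁻ t : UnitAddCircle, factorComponent P t E := by
  rw [symbolicFactor, Measure.map_apply (measurable_itinerary hP) hE, Measure.volume_eq_prod,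
    Measure.prod_apply (measurable_itinerary hP hE)]
  refine lintegral_congr fun t => ?_
  rw [factorComponent, Measure.map_apply (measurable_itinerary_circle hP t) hE]
  rfl

/-- On a single circle the itinerary map is a factor map from the rotation by `t` to the shift, and
ergodicity passes to factors. -/
lemma ergodic_factorComponent (hP : Measurable P) {t : UnitAddCircle}
    (ht : Ergodic (circleRotation t) (volume : Measure UnitAddCircle)) :
    Ergodic shift (factorComponent P t) :=
  MeasurePreserving.ergodic_of_ergodic_semiconj
    (g := fun s => itinerary P (t, s)) ⟨measurable_itinerary_circle hP t, rfl⟩ ht measurable_shift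
    fun s => semiconj_itinerary P (t, s)

/-- The first symbol suffices: a point mass at `x` would put almost all of the circle in the cell
labelled `x 0`. -/
lemma factorComponent_ne_dirac (hP : Measurable P) (hn : NontrivialOnErgodicCircles P)
    {t : UnitAddCircle} (ht : Ergodic (circleRotation t) (volume : Measure UnitAddCircle))
    (x : ℕ → K) : factorComponent P t ≠ Measure.dirac x := by
  intro h
  refine hn t ht (x 0) ?_
  have hs : MeasurableSet {y : ℕ → K | y 0 = x 0} :=
    measurableSet_eq_fun (measurable_pi_apply 0) measurable_const
  have h1 : ∀ᵐ y ∂factorComponent P t, y 0 = x 0 := by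
    rw [h, ae_dirac_iff hs]
  exact ae_of_ae_map (measurable_itinerary_circle hP t).aemeasurable h1

/-- Disjointness is applied to the first coordinate and the conjugate first coordinate, which are
bounded because the alphabets lie in the unit disc. -/
lemma FurstenbergDisjoint.uncorrelated {L : Finset ℂ} (hK : ∀ a ∈ K, ‖a‖ ≤ 1)
    (hL : ∀ b ∈ L, ‖b‖ ≤ 1) {μ : Measure (ℕ → K)} {ν : Measure (ℕ → L)}
    (h : FurstenbergDisjoint shift μ shift ν) : Uncorrelated μ ν := by
  refine le_antisymm (iSup₂_le fun ξ hξ => ?_) bot_le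
  rw [h ξ hξ (fun x => (x 0 : ℂ)) (fun y => starRingEnd ℂ (y 0 : ℂ))
    (measurable_subtype_coe.comp (measurable_pi_apply 0))
    (Complex.continuous_conj.measurable.comp
      (measurable_subtype_coe.comp (measurable_pi_apply 0)))
    ⟨1, fun x => hK _ (x 0).2⟩ ⟨1, fun y => by rw [RCLike.norm_conj]; exact hL _ (y 0).2⟩]
  simp

end Itinerary

theorem mainTheorem10 :
    -- the Lebesgue measure is invariant and almost all of its invariant circles are ergodic
    MeasurePreserving skewMap (volume : Measure Torus2) volume ∧
    (∀ᵐ t : UnitAddCircle, Ergodic (circleRotation t) (volume : Measure UnitAddCircle)) ∧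
    -- the Lebesgue measure is disjoint from every ergodic measure
    (∀ (Y : Type*) [MeasurableSpace Y] (S : Y → Y) (ν : Measure Y) [IsProbabilityMeasure ν],
      Ergodic S ν → FurstenbergDisjoint skewMap (volume : Measure Torus2) S ν) ∧
    -- partitions that are nontrivial on every ergodic circle exist
    (∀ K : Finset ℂ, (∀ a ∈ K, ‖a‖ ≤ 1) → 2 ≤ K.card →
      ∃ P : Torus2 → K, Measurable P ∧ NontrivialOnErgodicCircles P) ∧
    -- the symbolic factors
    (∀ K : Finset ℂ, (∀ a ∈ K, ‖a‖ ≤ 1) → ∀ P : Torus2 → K, Measurable P →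
      IsProbabilityMeasure (symbolicFactor P) ∧
      MeasurePreserving shift (symbolicFactor P) (symbolicFactor P) ∧
      MeasurePreserving (itinerary P) (volume : Measure Torus2) (symbolicFactor P) ∧
      Function.Semiconj (itinerary P) skewMap shift ∧
      (∀ (Y : Type*) [MeasurableSpace Y] (S : Y → Y) (ν : Measure Y) [IsProbabilityMeasure ν],
        Ergodic S ν → FurstenbergDisjoint shift (symbolicFactor P) S ν) ∧
      (∀ L : Finset ℂ, (∀ b ∈ L, ‖b‖ ≤ 1) →
        ∀ (ν : Measure (ℕ → L)) [IsProbabilityMeasure ν], Ergodic shift ν →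
          Uncorrelated (symbolicFactor P) ν) ∧
      -- the ergodic components of the factor, nontrivial if the partition is
      (∀ E : Set (ℕ → K), MeasurableSet E →
        symbolicFactor P E = ∫⁻ t : UnitAddCircle, factorComponent P t E) ∧
      (∀ t : UnitAddCircle, Ergodic (circleRotation t) (volume : Measure UnitAddCircle) →
        Ergodic shift (factorComponent P t)) ∧
      (NontrivialOnErgodicCircles P →
        ∀ t : UnitAddCircle, Ergodic (circleRotation t) (volume : Measure UnitAddCircle) →
          ¬ ∃ x : ℕ → K, factorComponent P t = Measure.dirac x)) := by
  refine ⟨measurePreserving_skewMap, ae_ergodic_circleRotation,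
    fun Y _ S ν _ hS => furstenbergDisjoint_skewMap hS,
    fun K _ hK => exists_nontrivialOnErgodicCircles hK, fun K hK P hP => ?_⟩
  refine ⟨isProbabilityMeasure_symbolicFactor hP, measurePreserving_shift_symbolicFactor hP,
    measurePreserving_itinerary hP, semiconj_itinerary P, ?_, ?_,
    fun E hE => symbolicFactor_apply hP hE, fun t ht => ergodic_factorComponent hP ht, ?_⟩
  · exact fun Y _ S ν _ hS =>
      furstenbergDisjoint_of_semiconj_skewMap hS (measurable_itinerary hP) (semiconj_itinerary P)
  · exact fun L hL ν _ hν => FurstenbergDisjoint.uncorrelated hK hL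
      (furstenbergDisjoint_of_semiconj_skewMap hν (measurable_itinerary hP) (semiconj_itinerary P))
  · rintro hn t ht ⟨x, hx⟩
    exact factorComponent_ne_dirac hP hn ht x hx
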